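/- Let $\tau>1$, $0<p<1$, and let $\psi_{\tau,p}(x)=|x|-\frac{|x|^{1+p}}{(1+p)\tau}$ for $|x|\le\tau^{1/p}$ and $\psi_{\tau,p}(x)=\frac{p\,\tau^{1/p}}{1+p}$ for $|x|>\tau^{1/p}$. For a third-order tensor $\mathcal X\in\mathbb R^{m\times n\times r}$ let $\bar{\mathcal X}^{(l)}=\sum_{k=0}^{r-1}e^{-2\pi i kl/r}\,\mathcal X(:,:,k)$ ($l=0,\dots,r-1$) be the frontal slices of its discrete Fourier transform along the third mode, and put $\|\mathcal X\|_{\tau p}=\frac1r\sum_{l}\sum_{i=1}^{\min(m,n)}\psi_{\tau,p}(\sigma_i(\bar{\mathcal X}^{(l)}))$, where $\sigma_i$ denotes the $i$-th singular value. Let $\mathcal O\in\mathbb R^{J_1\times\cdots\times J_N}$ be an $N$th-order tensor and $\Omega$ a set of index positions; $\mathcal P_\Omega$ keeps the entries in $\Omega$ and sets all others to zero, and $\Omega^c$ is the complement of $\Omega$. Let $q$ run over the $N(N-1)/2$ pairs of modes $q_1<q_2$. The mode-$q$ unfolding $\mathcal X_{<q>}\in\mathbb R^{J_{q_1}\times J_{q_2}\times\prod_{s\ne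 q_1,q_2}J_s}$ has the entry $\mathcal X_{j_1\dots j_N}$ at position $(j_{q_1},j_{q_2},k)$, $k=1+\sum_{s\ne q_1,q_2}(j_s-1)\prod_{t<s,\,t\ne q_1,q_2}J_t$. Let $\beta_q\ge0$ with $\sum_q\beta_q=1$, $\rho_q^0>0$, $\mu>1$ and $\rho_q^k=\mu^k\rho_q^0$. Let $\mathcal B^k,\mathcal M_q^k,\mathcal T_q^k$ $(k\ge0)$ be any sequences generated by the ADMM iteration (run without a stopping test): $\mathcal B^0=\mathcal P_\Omega(\mathcal O)$, $\mathcal M_q^0$ and $\mathcal T_q^0$ arbitrary, and for every $k\ge0$ and every $q$ $$\mathcal B^{k+1}=\mathcal P_{\Omega^c}\Bigl(\frac{\sum_q(\rho_q^k\mathcal M_q^k-\mathcal T_q^k)}{\sum_q\rho_q^k}\Bigr)+\mathcal P_\Omega(\mathcal O),$$ $$\mathcal M_q^{k+1}\in\operatorname*{arg\,min}_{\mathcal M}\ \beta_q\|\mathcal M_{<q>}\|_{\tau p}+\frac{\rho_q^k}{2}\Bigl\|\mathcal B^{k+1}-\mathcal M+\frac{\mathcal T_q^k}{\rho_q^k}\Bigr\|_F^2,$$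 $$\mathcal T_q^{k+1}=\mathcal T_q^k+\rho_q^k(\mathcal B^{k+1}-\mathcal M_q^{k+1}).$$ Then $\{\mathcal B^k\}$ is a Cauchy sequence and converges, and for every $q$ the sequence $\{\mathcal M_q^k\}$ is a Cauchy sequence and converges. -/

import Mathlib

namespace MPCP

/-- Real tensors of order `N` and size `J 1 × ⋯ × J N`. The norm of this space is the Frobenius
norm. -/
abbrev Tensor {N : ℕ} (J : Fin N → ℕ) : Type :=
  EuclideanSpace ℝ ((s : Fin N) → Fin (J s))

/-- The MPCP function `ψ_{τ,p}`. -/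
noncomputable def mpcp (τ p x : ℝ) : ℝ :=
  if |x| ≤ τ ^ (1 / p) then |x| - |x| ^ (1 + p) / ((1 + p) * τ)
  else p * τ ^ (1 / p) / (1 + p)

/-- The `l`-th frontal slice of the discrete Fourier transform `fft(X, [ ], 3)` of a third-order
tensor `X` along its third mode (indices start at `0`). -/
noncomputable def fftSlice {m n r : ℕ} (X : Fin m → Fin n → Fin r → ℝ) (l : Fin r) :
    Matrix (Fin m) (Fin n) ℂ :=
  Matrix.of fun a b => ∑ k : Fin r,
    Complex.exp (-(2 * Real.pi * Complex.I * ((l : ℕ) : ℂ) * ((k : ℕ) : ℂ) / (r : ℂ))) *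
      (X a b k : ℂ)

/-- The `i`-th largest singular value of a complex matrix (indices start at `0`). -/
noncomputable def singularValue {m n : ℕ} (A : Matrix (Fin m) (Fin n) ℂ) (i : ℕ) : ℝ :=
  (Matrix.toEuclideanLin A).singularValues i

/-- The tensor `p`-th order `τ` norm of a third-order tensor of size `m × n × r`. -/
noncomputable def tpNorm (τ p : ℝ) {m n r : ℕ} (X : Fin m → Fin n → Fin r → ℝ) : ℝ :=
  (1 / (r : ℝ)) * ∑ l : Fin r, ∑ i ∈ Finset.range (min m n),
    mpcp τ p (singularValue (fftSlice X l) i)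

/-- The pairs of modes `q₁ < q₂` that number the unfoldings. -/
abbrev ModePair (N : ℕ) : Type := {q : Fin N × Fin N // q.1 < q.2}

/-- The sizes `J s`, with the sizes of the two modes in `q` replaced by `1`; their product is
`∏_{s ≠ q₁, q₂} J s`. -/
def restSize {N : ℕ} (J : Fin N → ℕ) (q : ModePair N) (s : Fin N) : ℕ :=
  if s = q.1.1 ∨ s = q.1.2 then 1 else J s

/-- The multi-index of the entry of an order-`N` tensor that the mode-`q` unfolding puts at
position `(a, b, k)`: mode `q₁` has index `a`, mode `q₂` has index `b`, and the indices of the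
other modes are the mixed-radix digits of `k`, the lowest mode varying fastest. -/
def unfoldIndex {N : ℕ} (J : Fin N → ℕ) (q : ModePair N)
    (a : Fin (J q.1.1)) (b : Fin (J q.1.2)) (k : Fin (∏ s, restSize J q s)) :
    (s : Fin N) → Fin (J s) := fun s =>
  if h₁ : s = q.1.1 then Fin.cast (by rw [h₁]) a
  else if h₂ : s = q.1.2 then Fin.cast (by rw [h₂]) b
  else Fin.cast (by simp [restSize, h₁, h₂]) (finPiFinEquiv.symm k s)

/-- The mode-`q` unfolding `X_{<q>}`, a third-order tensor of size
`J q₁ × J q₂ × ∏_{s ≠ q₁, q₂} J s`. -/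
def unfold {N : ℕ} {J : Fin N → ℕ} (q : ModePair N) (X : Tensor J) :
    Fin (J q.1.1) → Fin (J q.1.2) → Fin (∏ s, restSize J q s) → ℝ :=
  fun a b k => X (unfoldIndex J q a b k)

/-- The unfolding in its usual description: the entry of `X` at `(j 1, …, j N)` goes to position
`(j q₁, j q₂, k)` with `k = ∑_{s ≠ q₁, q₂} j s * ∏_{t < s, t ≠ q₁, q₂} J t` (indices start
at `0`). -/
theorem unfold_apply {N : ℕ} {J : Fin N → ℕ} (q : ModePair N) (X : Tensor J)
    (j : (s : Fin N) → Fin (J s)) :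
    ∃ k : Fin (∏ s, restSize J q s),
      (k : ℕ) = ∑ s with s ≠ q.1.1 ∧ s ≠ q.1.2,
        (j s : ℕ) * ∏ t with t < s ∧ t ≠ q.1.1 ∧ t ≠ q.1.2, J t ∧
      unfold q X (j q.1.1) (j q.1.2) k = X j := by
  let g : (s : Fin N) → Fin (restSize J q s) := fun s =>
    if h : s = q.1.1 ∨ s = q.1.2 then ⟨0, by simp [restSize, h]⟩
    else Fin.cast (by simp [restSize, h]) (j s)
  refine ⟨finPiFinEquiv g, ?_, ?_⟩
  · rw [finPiFinEquiv_apply, Finset.sum_filter]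
    refine Finset.sum_congr rfl fun s _ => ?_
    by_cases h : s = q.1.1 ∨ s = q.1.2
    · have h' : ¬ (s ≠ q.1.1 ∧ s ≠ q.1.2) := by tauto
      simp [g, h, h']
    · have h' : s ≠ q.1.1 ∧ s ≠ q.1.2 := by tauto
      rw [if_pos h']
      have hg : ((g s : Fin _) : ℕ) = j s := by simp [g, h]
      rw [hg]
      congr 1
      have e : ∏ t with t < s ∧ t ≠ q.1.1 ∧ t ≠ q.1.2, J t
          = ∏ t with t < s, restSize J q t := by
        rw [Finset.prod_filter, Finset.prod_filter]
        refine Finset.prod_congr rfl fun t _ => ?_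
        by_cases h1 : t < s <;> by_cases h2 : t = q.1.1 <;> by_cases h3 : t = q.1.2 <;>
          simp [restSize, h1, h2, h3]
      rw [e]
      refine Finset.prod_bij (fun (i : Fin s) _ => Fin.castLE s.is_lt.le i) ?_ ?_ ?_ ?_
      · intro i _
        simpa using Fin.lt_def.mpr i.is_lt
      · intro i _ i' _ hi
        exact Fin.castLE_injective _ hi
      · intro t ht
        simp only [Finset.mem_filter, Finset.mem_univ, true_and] at ht
        exact ⟨⟨t, ht⟩, Finset.mem_univ _, rfl⟩
      · intro i _
        rfl
  · refine congrArg (fun i => X i) (funext fun s => ?_)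
    unfold unfoldIndex
    by_cases h₁ : s = q.1.1
    · subst h₁; simp
    · by_cases h₂ : s = q.1.2
      · subst h₂; simp [h₁]
      · simp [h₁, h₂, g]

/-- The projection `P_Ω`, which keeps the entries in `Ω` and sets the others to zero. -/
noncomputable def proj {N : ℕ} {J : Fin N → ℕ} (Ω : Set ((s : Fin N) → Fin (J s)))
    (X : Tensor J) : Tensor J :=
  WithLp.toLp 2 (Ω.indicator fun j => X j)

/-- The penalty parameter `ρ_q^k = μ^k ρ_q^0`. -/
def penalty {N : ℕ} (μ : ℝ) (ρ₀ : ModePair N → ℝ) (k : ℕ) (q : ModePair N) : ℝ :=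
  μ ^ k * ρ₀ q

/-- The sequences `B^k`, `M_q^k`, `T_q^k` are generated by the ADMM iteration for the MPCP-based
completion of the tensor `O` observed on `Ω`. The tensors `M_q^0` and `T_q^0` are arbitrary. The
`M`-update may be any minimizer of its (nonconvex) subproblem. -/
structure IsADMMSequence {N : ℕ} {J : Fin N → ℕ} (τ p : ℝ) (β : ModePair N → ℝ)
    (O : Tensor J) (Ω : Set ((s : Fin N) → Fin (J s))) (μ : ℝ) (ρ₀ : ModePair N → ℝ)
    (B : ℕ → Tensor J) (M T : ModePair N → ℕ → Tensor J) : Prop where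
  init : B 0 = proj Ω O
  updateB : ∀ k, B (k + 1) =
    proj Ωᶜ ((∑ q, penalty μ ρ₀ k q)⁻¹ • ∑ q, (penalty μ ρ₀ k q • M q k - T q k)) + proj Ω O
  updateM : ∀ k q, IsMinOn
    (fun X : Tensor J => β q * tpNorm τ p (unfold q X) +
      penalty μ ρ₀ k q / 2 * ‖B (k + 1) - X + (penalty μ ρ₀ k q)⁻¹ • T q k‖ ^ 2)
    Set.univ (M q (k + 1))
  updateT : ∀ k q, T q (k + 1) = T q k + penalty μ ρ₀ k q • (B (k + 1) - M q (k + 1))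

end MPCP

/-! The regularizer `tpNorm` is nonconvex but globally Lipschitz: `mpcp` is 1-Lipschitz, singular
values are Lipschitz by Weyl's inequality, and the Fourier slices depend linearly on the tensor.
Comparing the minimizer in the M-update with the centre `B + T/ρ` of its quadratic term therefore
bounds `ρ` times their distance. By the T-update that product is the norm of the new multiplier, so
the multipliers stay bounded (`exists_norm_multiplier_le`). Hence `M - B`, a difference of two
multipliers over `ρ`, is of order `μ⁻¹ ^ k`. So is each step of `B`, which is a projected weighted
average of `M - B` minus multiplier terms. Thus `B` converges geometrically, and every `M q` has the
same limit. -/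

/-! ### Weyl's inequality for singular values -/

open Module in
/-- In the eigenbasis of `T† T`, the form `‖T v‖ ^ 2` is diagonal, with the squares of the singular
values as coefficients. -/
theorem LinearMap.norm_apply_sq_eq_sum_singularValues {𝕜 E F : Type*} [RCLike 𝕜]
    [NormedAddCommGroup E] [InnerProductSpace 𝕜 E] [FiniteDimensional 𝕜 E]
    [NormedAddCommGroup F] [InnerProductSpace 𝕜 F] [FiniteDimensional 𝕜 F]
    (T : E →ₗ[𝕜] F) {n : ℕ} (hn : finrank 𝕜 E = n) (v : E) :
    ‖T v‖ ^ 2 = ∑ j : Fin n, T.singularValues j ^ 2 *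
      ‖(T.isSymmetric_adjoint_comp_self.eigenvectorBasis hn).repr v j‖ ^ 2 := by
  set b := T.isSymmetric_adjoint_comp_self.eigenvectorBasis hn with hb
  have h1 : ((‖T v‖ ^ 2 : ℝ) : 𝕜) = inner 𝕜 v ((adjoint T ∘ₗ T) v) := by
    rw [LinearMap.comp_apply, LinearMap.adjoint_inner_right, inner_self_eq_norm_sq_to_K]
    push_cast; rfl
  rw [← b.sum_inner_mul_inner] at h1
  have h2 : ∀ j, inner 𝕜 v (b j) * inner 𝕜 (b j) ((adjoint T ∘ₗ T) v) =
      ((T.singularValues j ^ 2 * ‖b.repr v j‖ ^ 2 : ℝ) : 𝕜) := by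
    intro j
    rw [← b.repr_apply_apply ((adjoint T ∘ₗ T) v), hb,
      T.isSymmetric_adjoint_comp_self.eigenvectorBasis_apply_self_apply hn, ← hb,
      T.sq_singularValues_fin hn, b.repr_apply_apply, mul_left_comm, ← inner_conj_symm v,
      RCLike.conj_mul]
    push_cast; rfl
  simp_rw [h2] at h1
  exact_mod_cast h1

open Module in
/-- **Weyl's inequality** for singular values. -/
theorem LinearMap.singularValues_le_add {𝕜 E F : Type*} [RCLike 𝕜]
    [NormedAddCommGroup E] [InnerProductSpace 𝕜 E] [FiniteDimensional 𝕜 E]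
    [NormedAddCommGroup F] [InnerProductSpace 𝕜 F] [FiniteDimensional 𝕜 F]
    (T S : E →ₗ[𝕜] F) {C : ℝ} (hC : 0 ≤ C) (h : ∀ v, ‖(T - S) v‖ ≤ C * ‖v‖) (i : ℕ) :
    T.singularValues i ≤ S.singularValues i + C := by
  obtain hi | hi := le_or_gt (finrank 𝕜 E) i
  · rw [T.singularValues_of_finrank_le hi, S.singularValues_of_finrank_le hi]
    linarith
  obtain ⟨n, hn⟩ : ∃ n, finrank 𝕜 E = n := ⟨_, rfl⟩
  rw [hn] at hi
  set b := T.isSymmetric_adjoint_comp_self.eigenvectorBasis hn with hb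
  set c := S.isSymmetric_adjoint_comp_self.eigenvectorBasis hn with hc
  let i' : Fin n := ⟨i, hi⟩
  -- These are `n - 1` linear conditions in dimension `n`, so some `v ≠ 0` meets them all. It has
  -- only components `j ≤ i` in the basis `b` of `T`, where `σ_j(T) ≥ σ_i(T)`, and only `j ≥ i` in
  -- the basis `c` of `S`, where `σ_j(S) ≤ σ_i(S)`.
  let f : E →ₗ[𝕜] ({j : Fin n // j ≠ i'} → 𝕜) :=
    LinearMap.pi fun j => if j.1 < i' then c.toBasis.coord j.1 else b.toBasis.coord j.1
  have hf : LinearMap.ker f ≠ ⊥ := by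
    apply LinearMap.ker_ne_bot_of_finrank_lt
    rw [Module.finrank_fintype_fun_eq_card, Fintype.card_subtype_compl]
    simp [hn]
    omega
  obtain ⟨v, hv, hv0⟩ := Submodule.exists_mem_ne_zero_of_ne_bot hf
  have hfv : ∀ j : Fin n, (j < i' → c.repr v j = 0) ∧ (i' < j → b.repr v j = 0) := by
    intro j
    constructor <;> intro hj
    · have := congrFun (LinearMap.mem_ker.1 hv) ⟨j, hj.ne⟩
      simpa [f, hj] using this
    · have := congrFun (LinearMap.mem_ker.1 hv) ⟨j, hj.ne'⟩
      simpa [f, hj.not_gt] using this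
  have hT : T.singularValues i * ‖v‖ ≤ ‖T v‖ := by
    refine le_of_sq_le_sq ?_ (norm_nonneg _)
    rw [T.norm_apply_sq_eq_sum_singularValues hn, mul_pow, ← b.repr.norm_map v,
      EuclideanSpace.norm_sq_eq, Finset.mul_sum]
    refine Finset.sum_le_sum fun j _ => ?_
    obtain hj | hj := le_or_gt j i'
    · exact mul_le_mul_of_nonneg_right (pow_le_pow_left₀ (T.singularValues_nonneg _)
        (T.singularValues_antitone hj) 2) (sq_nonneg _)
    · simp [(hfv j).2 hj, ← hb]
  have hS : ‖S v‖ ≤ S.singularValues i * ‖v‖ := by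
    refine le_of_sq_le_sq ?_ (mul_nonneg (S.singularValues_nonneg _) (norm_nonneg _))
    rw [S.norm_apply_sq_eq_sum_singularValues hn, mul_pow, ← c.repr.norm_map v,
      EuclideanSpace.norm_sq_eq, Finset.mul_sum]
    refine Finset.sum_le_sum fun j _ => ?_
    obtain hj | hj := lt_or_ge j i'
    · simp [(hfv j).1 hj, ← hc]
    · exact mul_le_mul_of_nonneg_right (pow_le_pow_left₀ (S.singularValues_nonneg _)
        (S.singularValues_antitone hj) 2) (sq_nonneg _)
  have hTS : ‖T v‖ ≤ ‖S v‖ + ‖(T - S) v‖ := by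
    have := norm_add_le (S v) ((T - S) v)
    simpa using this
  refine le_of_mul_le_mul_right ?_ (norm_pos_iff.2 hv0)
  rw [add_mul]
  linarith [h v]

/-! ### Lipschitz continuity of the regularizer -/

namespace MPCP

theorem mpcp_eq {τ p : ℝ} (hτ : 0 < τ) (hp : 0 < p) (x : ℝ) :
    mpcp τ p x = min |x| (τ ^ (1 / p)) - (min |x| (τ ^ (1 / p))) ^ (1 + p) / ((1 + p) * τ) := by
  unfold mpcp
  split_ifs with h
  · rw [min_eq_left h]
  · rw [min_eq_right (not_le.1 h).le, Real.rpow_add (Real.rpow_pos_of_pos hτ _), Real.rpow_one,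
      ← Real.rpow_mul hτ.le, one_div_mul_cancel hp.ne', Real.rpow_one]
    field_simp
    ring

/-- On `[0, τ^(1/p)]` the derivative `1 - t^p/τ` lies in `[0, 1]`; the absolute value and the
clipping at `τ^(1/p)` are nonexpansive. -/
theorem abs_mpcp_sub_mpcp_le {τ p : ℝ} (hτ : 0 < τ) (hp : 0 < p) (x y : ℝ) :
    |mpcp τ p x - mpcp τ p y| ≤ |x - y| := by
  set a := τ ^ (1 / p) with ha
  have ha0 : 0 < a := Real.rpow_pos_of_pos hτ _
  have hap : a ^ p = τ := by
    rw [ha, ← Real.rpow_mul hτ.le, one_div_mul_cancel hp.ne', Real.rpow_one]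
  have key := (convex_Icc (0 : ℝ) a).norm_image_sub_le_of_norm_hasDerivWithin_le (C := 1)
    (f := fun t : ℝ => t - t ^ (1 + p) / ((1 + p) * τ)) (f' := fun t => 1 - t ^ p / τ)
    (x := min |y| a) (y := min |x| a)
    (fun t _ => by
      have h := (hasDerivAt_id t).sub
        ((Real.hasDerivAt_rpow_const (x := t) (p := 1 + p) (Or.inr (by linarith))).div_const
          ((1 + p) * τ))
      refine (h.congr_deriv ?_).hasDerivWithinAt
      rw [add_sub_cancel_left]
      field_simp)
    (fun t ht => by
      have h0 : 0 ≤ t ^ p / τ := div_nonneg (Real.rpow_nonneg ht.1 _) hτ.le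
      have h1 : t ^ p / τ ≤ 1 := by
        rw [div_le_one hτ, ← hap]
        exact Real.rpow_le_rpow ht.1 ht.2 hp.le
      rw [Real.norm_eq_abs, abs_le]
      constructor <;> linarith)
    ⟨le_min (abs_nonneg _) ha0.le, min_le_right _ _⟩ ⟨le_min (abs_nonneg _) ha0.le, min_le_right _ _⟩
  rw [mpcp_eq hτ hp, mpcp_eq hτ hp]
  rw [one_mul, Real.norm_eq_abs, Real.norm_eq_abs] at key
  refine key.trans ?_
  have h1 := abs_min_sub_min_le_max |x| a |y| a
  rw [sub_self, abs_zero, max_eq_left (abs_nonneg _)] at h1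
  exact h1.trans (abs_abs_sub_abs_le x y)

/-- The operator of a Fourier slice of an unfolding, as a linear function of the tensor. -/
noncomputable def fftSliceLin {N : ℕ} {J : Fin N → ℕ} (q : ModePair N)
    (l : Fin (∏ s, restSize J q s)) : Tensor J →ₗ[ℝ]
      (EuclideanSpace ℂ (Fin (J q.1.2)) →L[ℂ] EuclideanSpace ℂ (Fin (J q.1.1))) where
  toFun X := LinearMap.toContinuousLinearMap (Matrix.toEuclideanLin (fftSlice (unfold q X) l))
  map_add' X Y := by
    rw [← map_add, ← map_add]
    congr 2
    ext a b
    simp [fftSlice, unfold, mul_add, Finset.sum_add_distrib]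
  map_smul' c X := by
    ext v a
    simp [fftSlice, unfold, Matrix.toLpLin_apply, Matrix.mulVec, dotProduct, Finset.mul_sum,
      Finset.sum_mul, mul_assoc, mul_left_comm]

/-- Weyl's inequality, with the norm of the linear map `fftSliceLin` as the constant. -/
theorem exists_singularValue_fftSlice_sub_le {N : ℕ} {J : Fin N → ℕ} (q : ModePair N)
    (l : Fin (∏ s, restSize J q s)) : ∃ C, 0 ≤ C ∧ ∀ (X Y : Tensor J) (i : ℕ),
      |singularValue (fftSlice (unfold q X) l) i - singularValue (fftSlice (unfold q Y) l) i| ≤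
        C * ‖X - Y‖ := by
  refine ⟨‖(fftSliceLin q l).toContinuousLinearMap‖, ContinuousLinearMap.opNorm_nonneg _, ?_⟩
  have key : ∀ (X Y : Tensor J) (i : ℕ), singularValue (fftSlice (unfold q X) l) i ≤
      singularValue (fftSlice (unfold q Y) l) i +
        ‖(fftSliceLin (J := J) q l).toContinuousLinearMap‖ * ‖X - Y‖ := by
    intro X Y i
    refine LinearMap.singularValues_le_add _ _
      (mul_nonneg (ContinuousLinearMap.opNorm_nonneg _) (norm_nonneg _)) (fun v => ?_) i
    have h1 := ((fftSliceLin q l).toContinuousLinearMap (X - Y)).le_opNorm v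
    have h2 := (fftSliceLin q l).toContinuousLinearMap.le_opNorm (X - Y)
    refine le_trans (le_of_eq ?_) (h1.trans (mul_le_mul_of_nonneg_right h2 (norm_nonneg v)))
    rw [map_sub]
    rfl
  intro X Y i
  rw [abs_sub_le_iff]
  have h1 := key X Y i
  have h2 := key Y X i
  rw [norm_sub_rev Y X] at h2
  constructor <;> linarith

theorem exists_tpNorm_unfold_sub_le {N : ℕ} {J : Fin N → ℕ} {τ p : ℝ} (hτ : 0 < τ) (hp : 0 < p)
    (q : ModePair N) : ∃ L, 0 ≤ L ∧ ∀ X Y : Tensor J,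
      tpNorm τ p (unfold q X) - tpNorm τ p (unfold q Y) ≤ L * ‖X - Y‖ := by
  choose C hC0 hC using exists_singularValue_fftSlice_sub_le (J := J) q
  refine ⟨1 / ((∏ s, restSize J q s : ℕ) : ℝ) *
    ∑ l, ∑ _i ∈ Finset.range (min (J q.1.1) (J q.1.2)), C l, ?_, fun X Y => ?_⟩
  · exact mul_nonneg (by positivity)
      (Finset.sum_nonneg fun l _ => Finset.sum_nonneg fun _ _ => hC0 l)
  · unfold tpNorm
    rw [← mul_sub, mul_assoc, ← Finset.sum_sub_distrib, Finset.sum_mul]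
    refine mul_le_mul_of_nonneg_left (Finset.sum_le_sum fun l _ => ?_) (by positivity)
    rw [← Finset.sum_sub_distrib, Finset.sum_mul]
    exact Finset.sum_le_sum fun i _ =>
      (le_abs_self _).trans ((abs_mpcp_sub_mpcp_le hτ hp _ _).trans (hC l X Y i))

/-- A minimizer `X` of `f + ρ / 2 * ‖Y - ·‖ ^ 2` has `ρ * ‖Y - X‖` bounded when `f` is Lipschitz. -/
theorem mul_norm_sub_le_of_isMinOn {E : Type*} [SeminormedAddCommGroup E] {f : E → ℝ} {L ρ : ℝ}
    (hL : 0 ≤ L) (hf : ∀ X Y, f X - f Y ≤ L * ‖X - Y‖) {X Y : E}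
    (h : IsMinOn (fun Z => f Z + ρ / 2 * ‖Y - Z‖ ^ 2) Set.univ X) : ρ * ‖Y - X‖ ≤ 2 * L := by
  -- The competitor `Y` gives `ρ/2 * ‖Y - X‖^2 ≤ f Y - f X ≤ L * ‖Y - X‖`.
  have h1 := isMinOn_iff.1 h Y (Set.mem_univ _)
  simp only [sub_self, norm_zero] at h1
  have h2 := hf Y X
  obtain h0 | h0 := (norm_nonneg (Y - X)).eq_or_lt
  · rw [← h0]; linarith
  · refine le_of_mul_le_mul_right ?_ h0
    nlinarith

variable {N : ℕ} {J : Fin N → ℕ}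

theorem norm_proj_le (Ω : Set ((s : Fin N) → Fin (J s))) (X : Tensor J) : ‖proj Ω X‖ ≤ ‖X‖ := by
  refine le_of_sq_le_sq ?_ (norm_nonneg _)
  rw [EuclideanSpace.norm_sq_eq, EuclideanSpace.norm_sq_eq]
  refine Finset.sum_le_sum fun j _ => ?_
  by_cases hj : j ∈ Ω <;> simp [proj, hj, sq_nonneg]

/-- Both tensors agree with `O` on `Ω`, so their difference lives on `Ωᶜ`. -/
theorem proj_compl_add_sub (Ω : Set ((s : Fin N) → Fin (J s))) (X Y O : Tensor J) :
    proj Ωᶜ X + proj Ω O - (proj Ωᶜ Y + proj Ω O) =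
      proj Ωᶜ (X - (proj Ωᶜ Y + proj Ω O)) := by
  ext j
  by_cases hj : j ∈ Ω <;> simp [proj, hj]

theorem penalty_pos {μ : ℝ} (hμ : 0 < μ) {ρ₀ : ModePair N → ℝ} {q : ModePair N} (hρ₀ : 0 < ρ₀ q)
    (k : ℕ) : 0 < penalty μ ρ₀ k q :=
  mul_pos (pow_pos hμ k) hρ₀

theorem penalty_succ (μ : ℝ) (ρ₀ : ModePair N → ℝ) (k : ℕ) (q : ModePair N) :
    penalty μ ρ₀ (k + 1) q = μ * penalty μ ρ₀ k q := by
  simp only [penalty, pow_succ]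
  ring

/-! ### Estimates along the iteration -/

namespace IsADMMSequence

variable {τ p μ : ℝ} {β ρ₀ : ModePair N → ℝ} {O : Tensor J} {Ω : Set ((s : Fin N) → Fin (J s))}
  {B : ℕ → Tensor J} {M T : ModePair N → ℕ → Tensor J}

/-- The multipliers of the ADMM iteration are bounded. -/
theorem exists_norm_multiplier_le (h : IsADMMSequence τ p β O Ω μ ρ₀ B M T) (hτ : 0 < τ)
    (hp : 0 < p) (hμ : 0 < μ) {q : ModePair N} (hβ : 0 ≤ β q) (hρ₀ : 0 < ρ₀ q) :
    ∃ K, ∀ k, ‖T q k‖ ≤ K := by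
  obtain ⟨L, hL, hf⟩ := exists_tpNorm_unfold_sub_le (J := J) hτ hp q
  refine ⟨max ‖T q 0‖ (2 * (β q * L)), fun k => ?_⟩
  obtain _ | k := k
  · exact le_max_left _ _
  refine le_trans ?_ (le_max_right _ _)
  have hρ := penalty_pos hμ hρ₀ k
  have hT : T q (k + 1) = penalty μ ρ₀ k q •
      (B (k + 1) + (penalty μ ρ₀ k q)⁻¹ • T q k - M q (k + 1)) := by
    rw [h.updateT, add_sub_right_comm, smul_add _ (_ - _), smul_inv_smul₀ hρ.ne', add_comm]
  rw [hT, norm_smul, Real.norm_of_nonneg hρ.le]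
  refine mul_norm_sub_le_of_isMinOn (f := fun X : Tensor J => β q * tpNorm τ p (unfold q X))
    (mul_nonneg hβ hL) (fun X Y => ?_) ?_
  · rw [← mul_sub, mul_assoc]
    exact mul_le_mul_of_nonneg_left (hf X Y) hβ
  · simpa only [add_sub_right_comm] using h.updateM k q

/-- The primal residuals of the ADMM iteration are of the order of the inverse penalties. -/
theorem exists_penalty_mul_norm_sub_le (h : IsADMMSequence τ p β O Ω μ ρ₀ B M T) (hτ : 0 < τ)
    (hp : 0 < p) (hμ : 0 < μ) {q : ModePair N} (hβ : 0 ≤ β q) (hρ₀ : 0 < ρ₀ q) :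
    ∃ D, ∀ k, penalty μ ρ₀ k q * ‖M q k - B k‖ ≤ D := by
  obtain ⟨K, hK⟩ := h.exists_norm_multiplier_le hτ hp hμ hβ hρ₀
  -- The start is arbitrary and is bounded by itself. The factor `μ` appears because the residual at
  -- `k + 1` is controlled by the penalty at `k`.
  refine ⟨max (penalty μ ρ₀ 0 q * ‖M q 0 - B 0‖) (μ * (K + K)), fun k => ?_⟩
  obtain _ | k := k
  · exact le_max_left _ _
  refine le_trans ?_ (le_max_right _ _)
  have hρ := penalty_pos hμ hρ₀ k
  have hT : penalty μ ρ₀ k q • (M q (k + 1) - B (k + 1)) = T q k - T q (k + 1) := by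
    rw [h.updateT, ← neg_sub (B (k + 1)), smul_neg, sub_add_cancel_left]
  rw [penalty_succ, mul_assoc, ← Real.norm_of_nonneg hρ.le, ← norm_smul, hT]
  exact mul_le_mul_of_nonneg_left ((norm_sub_le _ _).trans (add_le_add (hK _) (hK _))) hμ.le

theorem eq_proj_compl_add (h : IsADMMSequence τ p β O Ω μ ρ₀ B M T) (k : ℕ) :
    ∃ Y, B k = proj Ωᶜ Y + proj Ω O := by
  obtain _ | k := k
  · refine ⟨0, ?_⟩
    rw [h.init]
    ext j
    simp [proj]
  · exact ⟨_, h.updateB k⟩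

/-- The steps of the completed tensor decay geometrically. -/
theorem exists_norm_sub_succ_le (h : IsADMMSequence τ p β O Ω μ ρ₀ B M T) (hτ : 0 < τ)
    (hp : 0 < p) (hμ : 0 < μ) (hβ : ∀ q, 0 ≤ β q) (hρ₀ : ∀ q, 0 < ρ₀ q)
    [Nonempty (ModePair N)] : ∃ C, ∀ k, ‖B (k + 1) - B k‖ ≤ C * μ⁻¹ ^ k := by
  choose K hK using fun q => h.exists_norm_multiplier_le hτ hp hμ (hβ q) (hρ₀ q)
  choose D hD using fun q => h.exists_penalty_mul_norm_sub_le hτ hp hμ (hβ q) (hρ₀ q)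
  refine ⟨(∑ q, ρ₀ q)⁻¹ * ∑ q, (D q + K q), fun k => ?_⟩
  have hS : 0 < ∑ q, penalty μ ρ₀ k q :=
    Finset.sum_pos (fun q _ => penalty_pos hμ (hρ₀ q) k) Finset.univ_nonempty
  -- The normalized weights sum to one, so `B k` can be moved inside the average.
  have hZ : (∑ q, penalty μ ρ₀ k q)⁻¹ • ∑ q, (penalty μ ρ₀ k q • M q k - T q k) - B k =
      (∑ q, penalty μ ρ₀ k q)⁻¹ • ∑ q, (penalty μ ρ₀ k q • (M q k - B k) - T q k) := by
    rw [← inv_smul_smul₀ hS.ne' (B k), ← smul_sub, inv_smul_smul₀ hS.ne', Finset.sum_smul,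
      ← Finset.sum_sub_distrib]
    simp only [smul_sub, sub_right_comm]
  have hB : B (k + 1) - B k = proj Ωᶜ ((∑ q, penalty μ ρ₀ k q)⁻¹ •
      ∑ q, (penalty μ ρ₀ k q • M q k - T q k) - B k) := by
    obtain ⟨Y, hY⟩ := h.eq_proj_compl_add k
    rw [h.updateB, hY, proj_compl_add_sub]
  have hsum : ‖∑ q, (penalty μ ρ₀ k q • (M q k - B k) - T q k)‖ ≤ ∑ q, (D q + K q) := by
    refine norm_sum_le_of_le _ fun q _ => (norm_sub_le _ _).trans (add_le_add ?_ (hK q k))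
    rw [norm_smul, Real.norm_of_nonneg (penalty_pos hμ (hρ₀ q) k).le]
    exact hD q k
  have hinv : (∑ q, penalty μ ρ₀ k q)⁻¹ = (∑ q, ρ₀ q)⁻¹ * μ⁻¹ ^ k := by
    simp only [penalty]
    rw [← Finset.mul_sum, mul_inv_rev, inv_pow]
  rw [hB]
  refine (norm_proj_le _ _).trans ?_
  rw [hZ, norm_smul, Real.norm_of_nonneg (inv_pos.2 hS).le]
  refine (mul_le_mul_of_nonneg_left hsum (inv_pos.2 hS).le).trans_eq ?_
  rw [hinv, mul_right_comm]

end IsADMMSequence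

end MPCP

theorem theorem5 {N : ℕ} (J : Fin N → ℕ) (τ p : ℝ) (hτ : 1 < τ) (hp₀ : 0 < p) (hp₁ : p < 1)
    (β : MPCP.ModePair N → ℝ) (hβ : ∀ q, 0 ≤ β q) (hβ₁ : ∑ q, β q = 1)
    (O : MPCP.Tensor J) (Ω : Set ((s : Fin N) → Fin (J s)))
    (μ : ℝ) (hμ : 1 < μ) (ρ₀ : MPCP.ModePair N → ℝ) (hρ₀ : ∀ q, 0 < ρ₀ q)
    (B : ℕ → MPCP.Tensor J) (M T : MPCP.ModePair N → ℕ → MPCP.Tensor J)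
    (h : MPCP.IsADMMSequence τ p β O Ω μ ρ₀ B M T) :
    (CauchySeq B ∧ ∃ Blim : MPCP.Tensor J, Filter.Tendsto B Filter.atTop (nhds Blim)) ∧
    ∀ q, CauchySeq (M q) ∧
      ∃ Mlim : MPCP.Tensor J, Filter.Tendsto (M q) Filter.atTop (nhds Mlim) := by
  have hτ₀ : 0 < τ := zero_lt_one.trans hτ
  have hμ₀ : 0 < μ := zero_lt_one.trans hμ
  have hμ₁ : μ⁻¹ < 1 := inv_lt_one_of_one_lt₀ hμ
  -- Without mode pairs the weights `β` would sum to `0`.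
  have : Nonempty (MPCP.ModePair N) := by
    by_contra hN
    rw [not_nonempty_iff] at hN
    simp at hβ₁
  obtain ⟨C, hC⟩ := h.exists_norm_sub_succ_le hτ₀ hp₀ hμ₀ hβ hρ₀
  have hB : CauchySeq B := cauchySeq_of_le_geometric μ⁻¹ C hμ₁ fun k => by
    rw [dist_comm, dist_eq_norm]
    exact hC k
  obtain ⟨Blim, hlim⟩ := cauchySeq_tendsto_of_complete hB
  refine ⟨⟨hB, Blim, hlim⟩, fun q => ?_⟩
  obtain ⟨D, hD⟩ := h.exists_penalty_mul_norm_sub_le hτ₀ hp₀ hμ₀ (hβ q) (hρ₀ q)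
  have hMB : Filter.Tendsto (fun k => M q k - B k) Filter.atTop (nhds 0) := by
    have hgeom : Filter.Tendsto (fun k : ℕ => D / ρ₀ q * μ⁻¹ ^ k) Filter.atTop (nhds 0) := by
      simpa using (tendsto_pow_atTop_nhds_zero_of_lt_one (inv_pos.2 hμ₀).le hμ₁).const_mul
        (D / ρ₀ q)
    refine squeeze_zero_norm (fun k => ?_) hgeom
    have hk := hD k
    rw [mul_comm, ← le_div_iff₀ (MPCP.penalty_pos hμ₀ (hρ₀ q) k)] at hk
    refine hk.trans_eq ?_
    rw [MPCP.penalty, inv_pow, mul_comm (μ ^ k), ← div_div, div_eq_mul_inv (D / ρ₀ q)]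
  have hM : Filter.Tendsto (M q) Filter.atTop (nhds Blim) := by
    simpa using hMB.add hlim
  exact ⟨hM.cauchySeq, Blim, hM⟩
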